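/- A set partition of $[n]=\{1,\dots,n\}$ is represented by its arcs $(i,j)$, where $i<j$ are consecutive elements (in numerical order) of one block. A $j$-nesting is a set of $j$ arcs $(i_1,h_1),\dots,(i_j,h_j)$ with $i_1<\dots<i_j<h_j<\dots<h_1$; its smallest vertex is $i_1$. A partition is $j$-nonnesting if it has no $j$-nesting. Put $a_2(\pi)=1+\#\{\text{blocks of }\pi\}$ if $\pi$ is $2$-nonnesting, and otherwise $a_2(\pi)=1+\#\{\text{blocks of }\pi\text{ whose largest element exceeds }v\}$, where $v$ is the largest among the smallest vertices of the $2$-nestings of $\pi$. Let $F_n$ be the number of $3$-nonnesting partitions of $[n]$ (so $F_0=1$), and let $F_n(k)$ be the number of those with $a_2(\pi)=k$. Write $\binom{N}{a,b,c}=\frac{N!}{a!\,b!\,c!}$ for $a+b+c=N$, and $\binom{k}{i}=0$ for $i<0$ or $i>k$. All summation indices $l_i,j_i$ are nonnegative integers, and empty sums are $0$. Then for every $n\ge 0$ $$F_n=\sum_{l_1+l_2+l_3=n}\binom{n}{l_1,l_2,l_3}\binom{n+1}{l_1,l_2,l_3+1}\Bigl(1-\frac{l_1}{l_2+1}\Bigr)-\sum_{n^*=0}^{n-1}\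 \sum_{k=1}^{n^*+1}F_{n^*}(k)\sum_{l_1+l_2+l_3=n-n^*-1}\binom{n-n^*-1}{l_1,l_2,l_3}\,C_{n-n^*,k}(l_1,l_2),$$ where, with $d=n-n^*$, $$C_{d,k}(l_1,l_2)=\sum_{j_2+j_3=d-1-l_1}\binom{d}{l_1+1,j_2,j_3}\binom{k}{l_2-j_2}-\sum_{j_1+j_3=d-2-l_2}\binom{d}{j_1,l_2+2,j_3}\binom{k}{l_1-j_1-1}$$ $$\qquad+\sum_{j_2+j_3=d-l_1}\binom{d}{l_1,j_2,j_3}\binom{k-1}{l_2-j_2}-\sum_{j_1+j_3=d-1-l_2}\binom{d}{j_1,l_2+1,j_3}\binom{k-1}{l_1-j_1-1}.$$ -/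

import Mathlib

namespace NonnestingPartition

/-- Set partitions of `[n] = {1, …, n}`. -/
abbrev SetPartition (n : ℕ) : Type := Finpartition (Finset.Icc 1 n)

/-- `(i, j)` is an arc of the standard representation of `π`: `i < j` are consecutive elements
(in numerical order) of one block. -/
def IsArc {n : ℕ} (π : SetPartition n) (i j : ℕ) : Prop :=
  i < j ∧ ∃ B ∈ π.parts, i ∈ B ∧ j ∈ B ∧ ∀ k ∈ B, ¬ (i < k ∧ k < j)

/-- The arcs `(a 0, b 0), …, (a (m-1), b (m-1))` form an `m`-nesting of `π`:
`a 0 < a 1 < ⋯ < a (m-1) < b (m-1) < ⋯ < b 1 < b 0`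
(the middle inequality is part of `IsArc`). -/
def IsNesting {n : ℕ} (π : SetPartition n) (m : ℕ) (a b : Fin m → ℕ) : Prop :=
  StrictMono a ∧ StrictAnti b ∧ ∀ r, IsArc π (a r) (b r)

/-- `π` is `m`-nonnesting: it contains no `m`-nesting. -/
def Nonnesting {n : ℕ} (π : SetPartition n) (m : ℕ) : Prop :=
  ¬ ∃ a b : Fin m → ℕ, IsNesting π m a b

/-- The smallest vertices of the `j`-nestings of `π` (for `j ≥ 1`). -/
def nestingMins {n : ℕ} (π : SetPartition n) (j : ℕ) : Set ℕ :=
  {v | ∃ (a b : Fin j → ℕ) (h : 0 < j), IsNesting π j a b ∧ a ⟨0, h⟩ = v}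

/-- The smallest vertex of the rightmost `j`-nesting: the largest of the smallest vertices of the
`j`-nestings (used only when `π` has a `j`-nesting, so that this is a genuine maximum). -/
noncomputable def rightmostMin {n : ℕ} (π : SetPartition n) (j : ℕ) : ℕ :=
  sSup (nestingMins π j)

open Classical in
/-- The label `a_j(π)`, `j ≥ 1`: one plus the number of blocks if `π` is `j`-nonnesting, and
otherwise one plus the number of blocks that end (have their largest element) to the right of the
smallest vertex of the rightmost `j`-nesting. -/
noncomputable def label {n : ℕ} (π : SetPartition n) (j : ℕ) : ℕ :=
  if Nonnesting π j then 1 + π.parts.card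
  else 1 + (π.parts.filter (fun B => ∃ x ∈ B, rightmostMin π j < x)).card

/-- `F_n`: the number of `3`-nonnesting set partitions of `[n]`. -/
noncomputable def F (n : ℕ) : ℕ :=
  Nat.card {π : SetPartition n // Nonnesting π 3}

/-- `F_n(k)`: the number of `3`-nonnesting set partitions `π` of `[n]` with `a_2(π) = k`. -/
noncomputable def Flabel (n k : ℕ) : ℕ :=
  Nat.card {π : SetPartition n // Nonnesting π 3 ∧ label π 2 = k}

/-- The multinomial coefficient `N! / (a! b! c!)` (where `a + b + c = N`, and zero otherwise). -/
def multinom (N a b c : ℕ) : ℕ :=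
  if a + b + c = N then Nat.multinomial Finset.univ ![a, b, c] else 0

/-- The binomial coefficient with an integer lower index, zero when that index is negative. -/
def binom (N : ℕ) (i : ℤ) : ℕ :=
  if 0 ≤ i then N.choose i.toNat else 0

/-- The triples `(l₁, l₂, l₃)` of natural numbers with `l₁ + l₂ + l₃ = N`. -/
def triples (N : ℕ) : Finset (ℕ × ℕ × ℕ) :=
  (Finset.range (N + 1) ×ˢ Finset.range (N + 1) ×ˢ Finset.range (N + 1)).filter
    (fun l => l.1 + l.2.1 + l.2.2 = N)

/-- The pairs `(j, j')` of natural numbers with `j + j' = N`, none if the integer `N` is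
negative. -/
def pairs (N : ℤ) : Finset (ℕ × ℕ) :=
  (Finset.range (N.toNat + 1) ×ˢ Finset.range (N.toNat + 1)).filter
    (fun j => (j.1 : ℤ) + j.2 = N)

end NonnestingPartition

namespace NonnestingPartition

open Finset

/-! This is the kernel method on a generating tree. Every partition of $[n+1]$ arises once from a
partition of $[n]$ by adding $n+1$ as a singleton or to a block with maximum $p$; the latter creates
the arc $(p,n+1)$, which can only be the outermost arc of a nesting. So $3$-nonnesting survives
exactly when $p$ is not left of the rightmost $2$-nesting, and the children depend only on two
statistics: the number $c$ of blocks ending after the last left endpoint of an arc, and the number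
$c+m$ ending after `rightmostMin π 2`, so that $a_2=c+m+1$.

Give $\pi$ the weight $(1+x+y)^{c+1}(1+y)^m$. Geometric sums over the children (`kernel_identity`,
`sum_childWeight`) give the functional equation `genBoth_succ` for $G_n(x,y)$. Its unknown `genArc`
depends only on $1+x+y$, hence is symmetric and disappears from $A_n=yG_n(x,y)-xG_n(y,x)$. Division
by $xy$ yields `antisym_succ`: $A_{n+1}=(1+x+y)(1+x^{-1}+y^{-1})A_n-{}$correction, where the
correction involves only the distribution of $a_2$.

Iterating (`antisym_eq`) and taking the coefficient of $x^0y^1$ gives the formula. On the left it is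
$G_n(0,0)=F_n$ (`coef_antisym`); on the right it is computed in `coef_main_term` and
`coef_correction_term`. -/

/-! ### Inserting the element $n+1$ into a set partition -/

theorem succ_notMem_block {n : ℕ} {π : SetPartition n} {B : Finset ℕ}
    (hB : B ∈ insert ∅ π.parts) : n + 1 ∉ B := by
  rcases mem_insert.1 hB with rfl | h
  · simp
  · intro hn
    have := π.subset h hn
    simp at this

/-- The partition of `[n + 1]` obtained by adding `n + 1` to the block `B` of `π`, or as a
singleton if `B` is empty. -/
def extendBlock {n : ℕ} (π : SetPartition n) (B : Finset ℕ) (hB : B ∈ insert ∅ π.parts) :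
    SetPartition (n + 1) :=
  Finpartition.ofExistsUnique (insert (insert (n + 1) B) (π.parts.erase B))
    (by
      have hs : ∀ t ∈ insert ∅ π.parts, t ⊆ Icc 1 (n + 1) := by
        intro t ht
        rcases mem_insert.1 ht with rfl | h
        · simp
        · exact (π.subset h).trans (Icc_subset_Icc le_rfl (Nat.le_succ n))
      intro t ht
      rcases mem_insert.1 ht with rfl | h
      · exact insert_subset (by simp) (hs B hB)
      · exact hs t (mem_insert_of_mem (mem_of_mem_erase h)))
    (by
      intro a ha
      have hN : ∀ t ∈ π.parts, n + 1 ∉ t := fun t ht => succ_notMem_block (mem_insert_of_mem ht)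
      rcases eq_or_ne a (n + 1) with rfl | hne
      · refine ⟨insert (n + 1) B, by simp, ?_⟩
        rintro t ⟨ht, hat⟩
        rcases mem_insert.1 ht with rfl | h
        · rfl
        · exact absurd hat (hN t (mem_of_mem_erase h))
      · have ha' : a ∈ Icc 1 n := by
          rw [mem_Icc] at *
          omega
        obtain ⟨t, ⟨ht, hat⟩, hu⟩ := π.existsUnique_mem ha'
        by_cases htB : t = B
        · subst htB
          refine ⟨insert (n + 1) t, by simp [hat], ?_⟩
          rintro u ⟨hu', hau⟩
          rcases mem_insert.1 hu' with rfl | h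
          · rfl
          · exact absurd (hu u ⟨mem_of_mem_erase h, hau⟩) (ne_of_mem_erase h)
        · refine ⟨t, by simp [ht, hat, htB], ?_⟩
          rintro u ⟨hu', hau⟩
          rcases mem_insert.1 hu' with rfl | h
          · rcases mem_insert.1 hau with h1 | h1
            · exact absurd h1 hne
            · rcases mem_insert.1 hB with rfl | h2
              · simp at h1
              · exact absurd (hu B ⟨h2, h1⟩).symm htB
          · exact hu u ⟨mem_of_mem_erase h, hau⟩)
    (by
      intro h
      rcases mem_insert.1 h with h | h
      · exact (insert_ne_empty _ _) h.symm
      · exact π.empty_notMem_parts (mem_of_mem_erase h))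

theorem parts_extendBlock {n : ℕ} (π : SetPartition n) (B : Finset ℕ)
    (hB : B ∈ insert ∅ π.parts) :
    (extendBlock π B hB).parts = insert (insert (n + 1) B) (π.parts.erase B) := rfl

/-- The inverse deletes $n+1$ from its block, discarding that block if it becomes empty; hence
$B=\emptyset$ encodes the singleton case. -/
theorem extendBlock_bijective (n : ℕ) :
    Function.Bijective (fun x : Σ π : SetPartition n, {B // B ∈ insert ∅ π.parts} =>
      extendBlock x.1 x.2.1 x.2.2) := by
  constructor
  · rintro ⟨π, B, hB⟩ ⟨σ, C, hC⟩ h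
    have hp : insert (insert (n + 1) B) (π.parts.erase B) =
        insert (insert (n + 1) C) (σ.parts.erase C) := congrArg Finpartition.parts h
    have hN : ∀ (τ : SetPartition n), ∀ t ∈ τ.parts, n + 1 ∉ t :=
      fun τ t ht => succ_notMem_block (mem_insert_of_mem ht)
    have hBC : insert (n + 1) B = insert (n + 1) C := by
      have : insert (n + 1) B ∈ insert (insert (n + 1) C) (σ.parts.erase C) := by
        rw [← hp]; simp
      rcases mem_insert.1 this with h | h
      · exact h
      · exact absurd (mem_insert_self _ _) (hN σ _ (mem_of_mem_erase h))
    have hBC' : B = C := by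
      have := congrArg (fun t => t.erase (n + 1)) hBC
      simpa [erase_insert (succ_notMem_block hB), erase_insert (succ_notMem_block hC)] using this
    subst hBC'
    have hE : π.parts.erase B = σ.parts.erase B := by
      have := congrArg (fun t => t.erase (insert (n + 1) B)) hp
      rwa [erase_insert, erase_insert] at this
      · exact fun h => hN σ _ (mem_of_mem_erase h) (mem_insert_self _ _)
      · exact fun h => hN π _ (mem_of_mem_erase h) (mem_insert_self _ _)
    have hπσ : π = σ := by
      apply Finpartition.ext
      by_cases hb : B = ∅
      · subst hb
        rwa [erase_eq_of_notMem π.empty_notMem_parts,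
          erase_eq_of_notMem σ.empty_notMem_parts] at hE
      · rw [← insert_erase ((mem_insert.1 hB).resolve_left hb), hE,
          insert_erase ((mem_insert.1 hC).resolve_left hb)]
    subst hπσ
    rfl
  · intro ρ
    have hmem : n + 1 ∈ Icc 1 (n + 1) := by simp
    set L := ρ.part (n + 1) with hL
    have hLp : L ∈ ρ.parts := ρ.part_mem.2 hmem
    have hnL : n + 1 ∈ L := ρ.mem_part_self.2 hmem
    have hsub : ∀ t ∈ ρ.parts, t ≠ L → n + 1 ∉ t := fun t ht hne hn =>
      hne (ρ.eq_of_mem_parts ht hLp hn hnL)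
    have hLn : ∀ t ∈ ρ.parts, L.erase (n + 1) = t → False := by
      intro t ht h
      obtain ⟨a, ha⟩ := ρ.nonempty_of_mem_parts ht
      have haL : a ∈ L := mem_of_mem_erase (h ▸ ha)
      have : t = L := ρ.eq_of_mem_parts ht hLp ha haL
      rw [← h] at this
      exact notMem_erase (n + 1) L (by rwa [this])
    let π : SetPartition n := Finpartition.ofExistsUnique
      ((insert (L.erase (n + 1)) (ρ.parts.erase L)).erase ∅)
      (by
        intro t ht a hat
        have h1 : a ≠ n + 1 ∧ a ∈ Icc 1 (n + 1) := by
          rcases mem_insert.1 (mem_of_mem_erase ht) with rfl | h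
          · exact ⟨ne_of_mem_erase hat, ρ.subset hLp (mem_of_mem_erase hat)⟩
          · refine ⟨?_, ρ.subset (mem_of_mem_erase h) hat⟩
            rintro rfl
            exact hsub t (mem_of_mem_erase h) (ne_of_mem_erase h) hat
        have h2 := mem_Icc.1 h1.2
        exact mem_Icc.2 ⟨h2.1, by have := h1.1; omega⟩)
      (by
        intro a ha
        have ha1 : a ∈ Icc 1 (n + 1) := Icc_subset_Icc le_rfl (Nat.le_succ n) ha
        have hne : a ≠ n + 1 := by
          have := mem_Icc.1 ha
          omega
        obtain ⟨t, ⟨ht, hat⟩, hu⟩ := ρ.existsUnique_mem ha1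
        by_cases htL : t = L
        · refine ⟨L.erase (n + 1), ?_, ?_⟩
          · have : a ∈ L.erase (n + 1) := mem_erase.2 ⟨hne, htL ▸ hat⟩
            exact ⟨mem_erase.2 ⟨ne_empty_of_mem this, mem_insert_self _ _⟩, this⟩
          · rintro u ⟨hu', hau⟩
            rcases mem_insert.1 (mem_of_mem_erase hu') with h | h
            · exact h
            · exact absurd ((hu u ⟨mem_of_mem_erase h, hau⟩).trans htL) (ne_of_mem_erase h)
        · refine ⟨t, ⟨mem_erase.2 ⟨ne_empty_of_mem hat,
            mem_insert_of_mem (mem_erase.2 ⟨htL, ht⟩)⟩, hat⟩, ?_⟩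
          rintro u ⟨hu', hau⟩
          rcases mem_insert.1 (mem_of_mem_erase hu') with rfl | h
          · exact absurd (hu L ⟨hLp, mem_of_mem_erase hau⟩).symm htL
          · exact hu u ⟨mem_of_mem_erase h, hau⟩)
      (notMem_erase _ _)
    have hπ : π.parts = (insert (L.erase (n + 1)) (ρ.parts.erase L)).erase ∅ := rfl
    have hB : L.erase (n + 1) ∈ insert ∅ π.parts := by
      rw [hπ, mem_insert, mem_erase, or_iff_not_imp_left]
      exact fun h => ⟨h, mem_insert_self _ _⟩
    refine ⟨⟨π, L.erase (n + 1), hB⟩, ?_⟩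
    apply Finpartition.ext
    change insert (insert (n + 1) (L.erase (n + 1))) (π.parts.erase (L.erase (n + 1))) = ρ.parts
    have : π.parts.erase (L.erase (n + 1)) = ρ.parts.erase L := by
      rw [hπ, erase_right_comm, erase_insert, erase_eq_of_notMem]
      · exact fun h => ρ.empty_notMem_parts (mem_of_mem_erase h)
      · exact fun h => hLn _ (mem_of_mem_erase h) rfl
    rw [this, insert_erase hnL, insert_erase hLp]

/-- Since $n+1$ exceeds every element, it leaves old arcs intact and is joined to the maximum of its
block. For empty $B$ the value `B.sup id` is $0$, which is never a block maximum. -/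
theorem isArc_extendBlock {n : ℕ} (π : SetPartition n) (B : Finset ℕ)
    (hB : B ∈ insert ∅ π.parts) (i j : ℕ) :
    IsArc (extendBlock π B hB) i j ↔
      IsArc π i j ∨ (j = n + 1 ∧ i = B.sup id ∧ B ≠ ∅) := by
  have hle : ∀ t ∈ insert ∅ π.parts, ∀ a ∈ t, a ≤ n := by
    intro t ht a ha
    rcases mem_insert.1 ht with rfl | h
    · simp at ha
    · exact (mem_Icc.1 (π.subset h ha)).2
  have hsup : ∀ a ∈ B, a ≤ B.sup id := fun a ha => le_sup (f := id) ha
  unfold IsArc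
  rw [parts_extendBlock]
  constructor
  · rintro ⟨hij, t, ht, hi, hj, hk⟩
    rcases mem_insert.1 ht with rfl | h
    · rcases mem_insert.1 hj with rfl | hjB
      · have hiB : i ∈ B := (mem_insert.1 hi).resolve_left (by omega)
        refine Or.inr ⟨rfl, le_antisymm (hsup i hiB) ?_, ne_empty_of_mem hiB⟩
        refine Finset.sup_le fun k hkB => ?_
        have h1 := hk k (mem_insert_of_mem hkB)
        have h2 := hle B hB k hkB
        simp only [id]
        omega
      · have hiB : i ∈ B := (mem_insert.1 hi).resolve_left (by have := hle B hB j hjB; omega)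
        exact Or.inl ⟨hij, B, (mem_insert.1 hB).resolve_left (ne_empty_of_mem hiB), hiB, hjB,
          fun k hkB => hk k (mem_insert_of_mem hkB)⟩
    · exact Or.inl ⟨hij, t, mem_of_mem_erase h, hi, hj, hk⟩
  · rintro (⟨hij, t, ht, hi, hj, hk⟩ | ⟨rfl, rfl, hne⟩)
    · by_cases htB : t = B
      · subst htB
        refine ⟨hij, insert (n + 1) t, mem_insert_self _ _, mem_insert_of_mem hi,
          mem_insert_of_mem hj, ?_⟩
        intro k hkt
        rcases mem_insert.1 hkt with rfl | h
        · have := hle t hB j hj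
          omega
        · exact hk k h
      · exact ⟨hij, t, mem_insert_of_mem (mem_erase.2 ⟨htB, ht⟩), hi, hj, hk⟩
    · obtain ⟨a, ha, hs⟩ := exists_mem_eq_sup B (nonempty_iff_ne_empty.2 hne) id
      refine ⟨?_, insert (n + 1) B, mem_insert_self _ _, mem_insert_of_mem (hs ▸ ha),
        mem_insert_self _ _, ?_⟩
      · rw [hs]
        exact Nat.lt_succ_of_le (hle B hB a ha)
      · intro k hk
        rcases mem_insert.1 hk with rfl | h
        · omega
        · have := hsup k h
          omega

/-- The set of the largest elements of the blocks of `π`. -/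
def maxima {n : ℕ} (π : SetPartition n) : Finset ℕ := π.parts.image (fun B => B.sup id)

theorem sup_mem_block {n : ℕ} {π : SetPartition n} {B : Finset ℕ} (hB : B ∈ π.parts) :
    B.sup id ∈ B := by
  obtain ⟨a, ha, hs⟩ := exists_mem_eq_sup B (π.nonempty_of_mem_parts hB) id
  rw [hs]
  exact ha

theorem sup_injOn_parts {n : ℕ} (π : SetPartition n) :
    Set.InjOn (fun B : Finset ℕ => B.sup id) (π.parts : Set (Finset ℕ)) := by
  intro B hB C hC h
  exact π.eq_of_mem_parts hB hC (sup_mem_block hB) (by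
    have : B.sup id = C.sup id := h
    rw [this]
    exact sup_mem_block hC)

theorem mem_maxima_bounds {n : ℕ} {π : SetPartition n} {p : ℕ} (hp : p ∈ maxima π) :
    1 ≤ p ∧ p ≤ n := by
  obtain ⟨B, hB, rfl⟩ := mem_image.1 hp
  exact mem_Icc.1 (π.subset hB (sup_mem_block hB))

theorem maxima_extendBlock {n : ℕ} (π : SetPartition n) (B : Finset ℕ)
    (hB : B ∈ insert ∅ π.parts) :
    maxima (extendBlock π B hB) = insert (n + 1) ((maxima π).erase (B.sup id)) := by
  have h1 : (insert (n + 1) B).sup id = n + 1 := by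
    rw [sup_insert, id, sup_eq_left]
    rcases mem_insert.1 hB with rfl | h
    · simp
    · exact (mem_maxima_bounds (mem_image_of_mem _ h)).2.trans (Nat.le_succ n)
  have h2 : (π.parts.erase B).image (fun B => B.sup id) = (maxima π).erase (B.sup id) := by
    rcases mem_insert.1 hB with rfl | h
    · rw [erase_eq_of_notMem π.empty_notMem_parts, erase_eq_of_notMem]
      · rfl
      · exact fun h => by simpa using (mem_maxima_bounds h).1
    · ext p
      simp only [mem_image, mem_erase, maxima]
      constructor
      · rintro ⟨C, ⟨hne, hC⟩, rfl⟩
        exact ⟨fun he => hne (sup_injOn_parts π hC h he), C, hC, rfl⟩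
      · rintro ⟨hne, C, hC, rfl⟩
        exact ⟨C, ⟨fun he => hne (he ▸ rfl), hC⟩, rfl⟩
  rw [maxima, parts_extendBlock, image_insert, h1, h2]

theorem notMem_maxima_of_isArc {n : ℕ} {π : SetPartition n} {i j : ℕ} (h : IsArc π i j) :
    i ∉ maxima π := by
  intro hi
  obtain ⟨hij, B, hB, hiB, hjB, -⟩ := h
  obtain ⟨C, hC, rfl⟩ := mem_image.1 hi
  have : B = C := π.eq_of_mem_parts hB hC hiB (sup_mem_block hC)
  subst this
  have : j ≤ B.sup id := le_sup (f := id) hjB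
  exact absurd (hij.trans_le this) (lt_irrefl _)

theorem isArc_bounds {n : ℕ} {π : SetPartition n} {i j : ℕ} (h : IsArc π i j) :
    1 ≤ i ∧ i < j ∧ j ≤ n := by
  obtain ⟨hij, B, hB, hiB, hjB, -⟩ := h
  exact ⟨(mem_Icc.1 (π.subset hB hiB)).1, hij, (mem_Icc.1 (π.subset hB hjB)).2⟩

/-- A sum over the set partitions of `[n + 1]` as a sum over those of `[n]` and the ways to insert
`n + 1`: as a singleton, or into the block with largest element `p`. -/
theorem sum_setPartition_succ {K : Type*} [AddCommMonoid K] (n : ℕ) (g : SetPartition (n + 1) → K)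
    (h : SetPartition n → ℕ → K)
    (hg : ∀ π B hB, g (extendBlock π B hB) = h π (B.sup id)) :
    ∑ ρ, g ρ = ∑ π, (h π 0 + ∑ p ∈ maxima π, h π p) := by
  rw [← (extendBlock_bijective n).sum_comp, Fintype.sum_sigma]
  refine sum_congr rfl fun π _ => ?_
  simp only [hg]
  rw [Finset.sum_coe_sort (insert ∅ π.parts) (fun B => h π (B.sup id)),
    sum_insert π.empty_notMem_parts, maxima, sum_image (sup_injOn_parts π)]
  simp


/-! ### Nestings and how insertion changes them -/

theorem nestingMins_two {n : ℕ} (π : SetPartition n) :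
    nestingMins π 2 = {v | ∃ j a b, IsArc π v j ∧ IsArc π a b ∧ v < a ∧ b < j} := by
  ext v
  constructor
  · rintro ⟨a, b, h, ⟨ha, hb, hr⟩, rfl⟩
    exact ⟨b 0, a 1, b 1, hr 0, hr 1, ha (by simp), hb (by simp)⟩
  · rintro ⟨j, a, b, h1, h2, h3, h4⟩
    refine ⟨![v, a], ![j, b], by simp, ⟨?_, ?_, ?_⟩, rfl⟩
    · rw [Fin.strictMono_iff_lt_succ]
      simpa using h3
    · rw [Fin.strictAnti_iff_succ_lt]
      simpa using h4
    · simpa [Fin.forall_fin_two] using ⟨h1, h2⟩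

theorem nonnesting_two_iff {n : ℕ} (π : SetPartition n) :
    Nonnesting π 2 ↔ nestingMins π 2 = ∅ := by
  rw [Set.eq_empty_iff_forall_notMem]
  constructor
  · rintro h v ⟨a, b, -, hab, -⟩
    exact h ⟨a, b, hab⟩
  · rintro h ⟨a, b, hab⟩
    exact h (a 0) ⟨a, b, by simp, hab, rfl⟩

theorem nonnesting_three_iff {n : ℕ} (π : SetPartition n) :
    Nonnesting π 3 ↔ ∀ i j, IsArc π i j →
      ∀ v a b c, IsArc π v a → IsArc π b c → v < b → c < a → i < v → ¬ a < j := by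
  unfold Nonnesting
  constructor
  · intro h i j hij v a b c hva hbc h1 h2 h3 h4
    refine h ⟨![i, v, b], ![j, a, c], ?_, ?_, ?_⟩
    · rw [Fin.strictMono_iff_lt_succ]
      simpa [Fin.forall_fin_two] using ⟨h3, h1⟩
    · rw [Fin.strictAnti_iff_succ_lt]
      simpa [Fin.forall_fin_two] using ⟨h4, h2⟩
    · intro r
      fin_cases r
      exacts [hij, hva, hbc]
  · rintro h ⟨a, b, ha, hb, hr⟩
    exact h (a 0) (b 0) (hr 0) (a 1) (b 1) (a 2) (b 2) (hr 1) (hr 2) (ha (by decide))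
      (hb (by decide)) (ha (by decide)) (hb (by decide))

/-- The largest left endpoint of an arc of `π`, zero if there is no arc. -/
noncomputable def lastOpener {n : ℕ} (π : SetPartition n) : ℕ := sSup {i | ∃ j, IsArc π i j}

theorem lt_sSup_iff_of_le {S : Set ℕ} {n : ℕ} (hS : ∀ i ∈ S, i ≤ n) (c : ℕ) :
    c < sSup S ↔ ∃ i ∈ S, c < i := by
  rcases S.eq_empty_or_nonempty with rfl | hne
  · simp
  · exact lt_csSup_iff ⟨n, hS⟩ hne

theorem lt_lastOpener_iff {n : ℕ} (π : SetPartition n) (c : ℕ) :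
    c < lastOpener π ↔ ∃ i j, IsArc π i j ∧ c < i := by
  rw [lastOpener, lt_sSup_iff_of_le (n := n)]
  · simp
  · rintro i ⟨j, h⟩
    have := isArc_bounds h
    omega

theorem lt_rightmostMin_iff {n : ℕ} (π : SetPartition n) (c : ℕ) :
    c < rightmostMin π 2 ↔
      ∃ i j a b, IsArc π i j ∧ IsArc π a b ∧ i < a ∧ b < j ∧ c < i := by
  rw [rightmostMin, nestingMins_two, lt_sSup_iff_of_le (n := n)]
  · constructor
    · rintro ⟨i, ⟨j, a, b, h1, h2, h3, h4⟩, h5⟩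
      exact ⟨i, j, a, b, h1, h2, h3, h4, h5⟩
    · rintro ⟨i, j, a, b, h1, h2, h3, h4, h5⟩
      exact ⟨i, ⟨j, a, b, h1, h2, h3, h4⟩, h5⟩
  · rintro i ⟨j, a, b, h, -⟩
    have := isArc_bounds h
    omega

theorem rightmostMin_le_lastOpener {n : ℕ} (π : SetPartition n) :
    rightmostMin π 2 ≤ lastOpener π := by
  refine le_of_forall_lt fun c hc => ?_
  obtain ⟨i, j, -, -, h, -, -, -, hci⟩ := (lt_rightmostMin_iff π c).1 hc
  exact (lt_lastOpener_iff π c).2 ⟨i, j, h, hci⟩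

theorem lastOpener_le {n : ℕ} (π : SetPartition n) : lastOpener π ≤ n := by
  by_contra h
  obtain ⟨i, j, hij, hn⟩ := (lt_lastOpener_iff π n).1 (not_le.1 h)
  have := isArc_bounds hij
  omega

/-- A block maximum opens no arc, whereas a positive `lastOpener` is attained as a left endpoint;
the default $0$ is below all maxima. -/
theorem lastOpener_ne {n : ℕ} {π : SetPartition n} {p : ℕ} (hp : p ∈ maxima π) :
    p ≠ lastOpener π := by
  rintro rfl
  have h1 := (mem_maxima_bounds hp).1
  obtain ⟨i, j, hij, hi⟩ := (lt_lastOpener_iff π (lastOpener π - 1)).1 (by omega)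
  have h2 : ¬ lastOpener π < i := fun h =>
    lt_irrefl _ ((lt_lastOpener_iff π (lastOpener π)).2 ⟨i, j, hij, h⟩)
  have : i = lastOpener π := by omega
  exact notMem_maxima_of_isArc hij (this ▸ hp)

theorem rightmostMin_ne {n : ℕ} {π : SetPartition n} {p : ℕ} (hp : p ∈ maxima π) :
    p ≠ rightmostMin π 2 := by
  rintro rfl
  have h1 := (mem_maxima_bounds hp).1
  obtain ⟨i, j, a, b, hij, h3, h4, h5, hi⟩ :=
    (lt_rightmostMin_iff π (rightmostMin π 2 - 1)).1 (by omega)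
  have h2 : ¬ rightmostMin π 2 < i := fun h =>
    lt_irrefl _ ((lt_rightmostMin_iff π (rightmostMin π 2)).2 ⟨i, j, a, b, hij, h3, h4, h5, h⟩)
  have : i = rightmostMin π 2 := by omega
  exact notMem_maxima_of_isArc hij (this ▸ hp)

theorem block_ne_empty_iff {n : ℕ} (π : SetPartition n) (B : Finset ℕ)
    (hB : B ∈ insert ∅ π.parts) : B ≠ ∅ ↔ B.sup id ≠ 0 := by
  constructor
  · intro hne h0
    have := (mem_maxima_bounds (mem_image_of_mem _ ((mem_insert.1 hB).resolve_left hne))).1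
    exact absurd (this.trans_eq h0) (by simp)
  · rintro h rfl
    simp at h

theorem lastOpener_extendBlock {n : ℕ} (π : SetPartition n) (B : Finset ℕ)
    (hB : B ∈ insert ∅ π.parts) :
    lastOpener (extendBlock π B hB) = max (lastOpener π) (B.sup id) := by
  refine eq_of_forall_lt_iff fun c => ?_
  rw [lt_max_iff, lt_lastOpener_iff, lt_lastOpener_iff]
  simp only [isArc_extendBlock, block_ne_empty_iff π B hB]
  constructor
  · rintro ⟨i, j, h | ⟨-, rfl, -⟩, hc⟩
    · exact Or.inl ⟨i, j, h, hc⟩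
    · exact Or.inr hc
  · rintro (⟨i, j, h, hc⟩ | hc)
    · exact ⟨i, j, Or.inl h, hc⟩
    · exact ⟨_, _, Or.inr ⟨rfl, rfl, by omega⟩, hc⟩

/-- The new arc ends at $n+1$, so it encloses exactly the arcs starting after `B.sup id`. It is the
outer arc of a new $2$-nesting precisely when such an arc exists. -/
theorem rightmostMin_extendBlock {n : ℕ} (π : SetPartition n) (B : Finset ℕ)
    (hB : B ∈ insert ∅ π.parts) :
    rightmostMin (extendBlock π B hB) 2 =
      if B.sup id < lastOpener π then max (rightmostMin π 2) (B.sup id)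
      else rightmostMin π 2 := by
  have key : ∀ c, c < rightmostMin (extendBlock π B hB) 2 ↔
      c < rightmostMin π 2 ∨ (c < B.sup id ∧ B.sup id < lastOpener π) := by
    intro c
    rw [lt_rightmostMin_iff, lt_rightmostMin_iff, lt_lastOpener_iff]
    simp only [isArc_extendBlock, block_ne_empty_iff π B hB]
    constructor
    -- The four cases say which of the outer and inner arcs is new; a new inner arc is impossible
    -- because nothing ends beyond $n+1$.
    · rintro ⟨i, j, a, b, h1 | ⟨rfl, rfl, h1⟩, h2 | ⟨rfl, rfl, h2⟩, h3, h4, h5⟩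
      · exact Or.inl ⟨i, j, a, b, h1, h2, h3, h4, h5⟩
      · have := isArc_bounds h1
        omega
      · exact Or.inr ⟨h5, a, b, h2, h3⟩
      · omega
    · rintro (⟨i, j, a, b, h1, h2, h3, h4, h5⟩ | ⟨h1, a, b, h2, h3⟩)
      · exact ⟨i, j, a, b, Or.inl h1, Or.inl h2, h3, h4, h5⟩
      · have := isArc_bounds h2
        exact ⟨_, _, a, b, Or.inr ⟨rfl, rfl, by omega⟩, Or.inl h2, h3, by omega, h1⟩
  refine eq_of_forall_lt_iff fun c => ?_
  rw [key]
  split_ifs with h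
  · simp [h]
  · simp [h]

/-- A new $3$-nesting is the new arc around an old $2$-nesting whose smallest vertex lies to the
right of `B.sup id`. -/
theorem nonnesting_three_extendBlock {n : ℕ} (π : SetPartition n) (B : Finset ℕ)
    (hB : B ∈ insert ∅ π.parts) :
    Nonnesting (extendBlock π B hB) 3 ↔
      Nonnesting π 3 ∧ (B.sup id = 0 ∨ rightmostMin π 2 ≤ B.sup id) := by
  rw [nonnesting_three_iff, nonnesting_three_iff, ← not_lt, lt_rightmostMin_iff,
    or_iff_not_imp_left]
  simp only [isArc_extendBlock, block_ne_empty_iff π B hB]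
  constructor
  · intro h
    refine ⟨fun i j hij v a b c h1 h2 => h i j (Or.inl hij) v a b c (Or.inl h1) (Or.inl h2), ?_⟩
    rintro h0 ⟨v, a, b, c, h1, h2, h3, h4, h5⟩
    have := isArc_bounds h1
    exact h _ _ (Or.inr ⟨rfl, rfl, h0⟩) v a b c (Or.inl h1) (Or.inl h2) h3 h4 h5 (by omega)
  · rintro ⟨h, h'⟩ i j h0 v a b c h1 h2 h3 h4 h5 h6
    have hj : j ≤ n + 1 := by
      rcases h0 with h0 | h0
      · have := isArc_bounds h0
        omega
      · omega
    rcases h1 with h1 | h1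
    swap
    · omega
    rcases h2 with h2 | h2
    swap
    · omega
    rcases h0 with h0 | ⟨rfl, rfl, h0⟩
    · exact h i j h0 v a b c h1 h2 h3 h4 h5 h6
    · exact h' h0 ⟨v, a, b, c, h1, h2, h3, h4, h5⟩

/-! ### Counting block maxima above a threshold -/

/-- The number of elements of `M` exceeding `v`. -/
def numAbove (M : Finset ℕ) (v : ℕ) : ℕ := #{q ∈ M | v < q}

theorem label_two {n : ℕ} (π : SetPartition n) :
    label π 2 = 1 + numAbove (maxima π) (rightmostMin π 2) := by
  have h : ∀ v, numAbove (maxima π) v = #{B ∈ π.parts | ∃ x ∈ B, v < x} := by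
    intro v
    rw [numAbove, maxima, filter_image, card_image_of_injOn]
    · congr 1
      ext B
      simp [Finset.lt_sup_iff]
    · exact (sup_injOn_parts π).mono (by
        rw [coe_subset]
        exact fun B hB => (mem_filter.1 hB).1)
  rw [label]
  split_ifs with h2
  -- With no $2$-nesting the supremum of the empty set is $0$, below every maximum, so one formula
  -- covers both cases of `label`.
  · have : rightmostMin π 2 = 0 := by
      rw [rightmostMin, (nonnesting_two_iff π).1 h2]
      simp
    rw [this, numAbove, filter_true_of_mem, maxima, card_image_of_injOn (sup_injOn_parts π)]
    exact fun p hp => (mem_maxima_bounds hp).1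
  · rw [h]

theorem label_two_mem {n : ℕ} (π : SetPartition n) : label π 2 ∈ Icc 1 (n + 1) := by
  have : numAbove (maxima π) (rightmostMin π 2) ≤ n :=
    calc _ ≤ #(maxima π) := card_filter_le _ _
      _ ≤ #(Icc 1 n) := card_le_card fun p hp => mem_Icc.2 (mem_maxima_bounds hp)
      _ = n := by simp
  rw [label_two, mem_Icc]
  omega

theorem numAbove_anti (M : Finset ℕ) {v v' : ℕ} (h : v ≤ v') : numAbove M v' ≤ numAbove M v :=
  card_le_card (monotone_filter_right _ fun _ _ h' => h.trans_lt h')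

theorem numAbove_lt_iff {M : Finset ℕ} {p v : ℕ} (hp : p ∈ M) :
    numAbove M p < numAbove M v ↔ v < p := by
  constructor
  · intro h
    by_contra hle
    exact absurd (numAbove_anti M (not_lt.1 hle)) (not_le.2 h)
  · intro h
    refine card_lt_card ?_
    rw [ssubset_iff_of_subset (monotone_filter_right _ fun _ _ h' => h.trans h')]
    exact ⟨p, by simp [hp, h], by simp⟩

/-- Membership of `p` in `M` is not required, so that `p = 0` covers the insertion of a singleton.
-/
theorem numAbove_insert_erase_of_le {M : Finset ℕ} {N p v : ℕ} (hM : ∀ q ∈ M, q < N) (hv : v < N)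
    (hp : p ≤ v) : numAbove (insert N (M.erase p)) v = numAbove M v + 1 := by
  have : {q ∈ M.erase p | v < q} = {q ∈ M | v < q} := by
    rw [filter_erase, erase_eq_of_notMem]
    simp only [mem_filter, not_and, not_lt]
    exact fun _ => hp
  rw [numAbove, filter_insert, if_pos hv, this, card_insert_of_notMem]
  · rfl
  · exact fun h => lt_irrefl _ (hM N (mem_filter.1 h).1)

theorem numAbove_insert_erase_of_lt {M : Finset ℕ} {N p v : ℕ} (hM : ∀ q ∈ M, q < N) (hv : v < N)
    (hpM : p ∈ M) (hp : v < p) : numAbove (insert N (M.erase p)) v = numAbove M v := by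
  rw [numAbove, filter_insert, if_pos hv, filter_erase, card_insert_of_notMem,
    card_erase_add_one]
  · rfl
  · simp [hpM, hp]
  · exact fun h => lt_irrefl _ (hM N (mem_filter.1 (mem_of_mem_erase h)).1)

/-- Listing $M$ from the top, its elements have $0,1,\dots,|M|-1$ elements above them. This turns
sums over block maxima into sums over an index. -/
theorem sum_numAbove {K : Type*} [AddCommMonoid K] (M : Finset ℕ) (f : ℕ → K) :
    ∑ p ∈ M, f (numAbove M p) = ∑ i ∈ range #M, f i := by
  induction M using Finset.induction_on_min with
  | empty => simp
  | insert a s ha ih =>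
    have hs : a ∉ s := fun h => lt_irrefl _ (ha a h)
    rw [sum_insert hs, card_insert_of_notMem hs, sum_range_succ, ← ih, add_comm]
    congr 1
    · refine sum_congr rfl fun p hp => ?_
      rw [numAbove, filter_insert, if_neg (ha p hp).not_gt]
      rfl
    · rw [numAbove, filter_insert, if_neg (lt_irrefl a), filter_true_of_mem ha]

theorem sum_numAbove_filter {K : Type*} [AddCommMonoid K] (M : Finset ℕ) (v : ℕ) (f : ℕ → K) :
    ∑ p ∈ M with v < p, f (numAbove M p) = ∑ i ∈ range (numAbove M v), f i := by
  rw [numAbove, ← sum_numAbove]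
  refine sum_congr rfl fun p hp => ?_
  congr 1
  rw [numAbove, numAbove, filter_filter]
  congr 1
  ext q
  have := (mem_filter.1 hp).2
  simp only [mem_filter]
  constructor
  · exact fun h => ⟨h.1, this.trans h.2, h.2⟩
  · exact fun h => ⟨h.1, h.2.2⟩


/-! ### The functional equation for the two statistics -/

/-- Split at $i=c$. The lower part is a geometric sum in $1+x+y$ and $1+y$, whose difference is $x$;
the upper part is geometric in $1+y$, where $(1+y)-1=y$. The factor $xy$ clears both denominators.
-/
theorem kernel_identity {K : Type*} [CommRing K] (x y : K) (c m : ℕ) :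
    x * y * ((1 + x + y) ^ (c + 2) * (1 + y) ^ m +
      ∑ i ∈ range (c + m), (if i < c then (1 + x + y) ^ (i + 2) * (1 + y) ^ (c + m - (i + 1))
        else (1 + x + y) ^ (c + 2) * (1 + y) ^ (i - c))) =
      (1 + x + y) * (x * y + x + y) * ((1 + x + y) ^ (c + 1) * (1 + y) ^ m)
        - y * (1 + x + y) ^ 2 * (1 + y) ^ (c + m)
        - x * (1 + x + y) * (1 + x + y) ^ (c + 1) := by
  have h1 : ∑ i ∈ range c, (if i < c then (1 + x + y) ^ (i + 2) * (1 + y) ^ (c + m - (i + 1))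
        else (1 + x + y) ^ (c + 2) * (1 + y) ^ (i - c)) =
      (1 + x + y) ^ 2 * (1 + y) ^ m * ∑ i ∈ range c, (1 + x + y) ^ i * (1 + y) ^ (c - 1 - i) := by
    rw [mul_sum]
    refine sum_congr rfl fun i hi => ?_
    have hi' := mem_range.1 hi
    rw [if_pos hi', show c + m - (i + 1) = m + (c - 1 - i) by omega, pow_add, pow_add]
    ring
  have h2 : ∑ i ∈ range m, (if c + i < c then
        (1 + x + y) ^ (c + i + 2) * (1 + y) ^ (c + m - (c + i + 1))
        else (1 + x + y) ^ (c + 2) * (1 + y) ^ (c + i - c)) =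
      (1 + x + y) ^ (c + 2) * ∑ i ∈ range m, (1 + y) ^ i := by
    rw [mul_sum]
    refine sum_congr rfl fun i _ => ?_
    rw [if_neg (by omega), Nat.add_sub_cancel_left]
  have g1 := geom_sum₂_mul (1 + x + y) (1 + y) c
  have g2 := geom_sum_mul (1 + y) m
  rw [sum_range_add, h1, h2]
  rw [show 1 + x + y - (1 + y) = x by ring] at g1
  rw [show 1 + y - 1 = y by ring] at g2
  rw [pow_add (1 + y) c m]
  linear_combination y * (1 + x + y) ^ 2 * (1 + y) ^ m * g1 + x * (1 + x + y) ^ (c + 2) * g2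

/-- The number of blocks ending after the last left endpoint of an arc. -/
noncomputable def endsAfterArc {n : ℕ} (π : SetPartition n) : ℕ :=
  numAbove (maxima π) (lastOpener π)

/-- The number of blocks ending after the smallest vertex of the rightmost `2`-nesting. -/
noncomputable def endsAfterNesting {n : ℕ} (π : SetPartition n) : ℕ :=
  numAbove (maxima π) (rightmostMin π 2)

theorem endsAfterArc_le {n : ℕ} (π : SetPartition n) : endsAfterArc π ≤ endsAfterNesting π :=
  numAbove_anti _ (rightmostMin_le_lastOpener π)

/-- The monomial recording the two labels of `π`. -/
noncomputable def weight {K : Type*} [CommRing K] {n : ℕ} (x y : K) (π : SetPartition n) : K :=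
  (1 + x + y) ^ (endsAfterArc π + 1) * (1 + y) ^ (endsAfterNesting π - endsAfterArc π)

open Classical in
/-- The contribution to the weight sum of inserting `n + 1` into the block with largest element
`p`, or as a singleton if `p = 0`. -/
noncomputable def childWeight {K : Type*} [CommRing K] {n : ℕ} (x y : K) (π : SetPartition n)
    (p : ℕ) : K :=
  if Nonnesting π 3 ∧ (p = 0 ∨ rightmostMin π 2 ≤ p) then
    (1 + x + y) ^ (numAbove (insert (n + 1) ((maxima π).erase p)) (max (lastOpener π) p) + 1) *
      (1 + y) ^ (numAbove (insert (n + 1) ((maxima π).erase p))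
        (if p < lastOpener π then max (rightmostMin π 2) p else rightmostMin π 2) -
          numAbove (insert (n + 1) ((maxima π).erase p)) (max (lastOpener π) p))
  else 0

open Classical in
theorem weight_extendBlock {K : Type*} [CommRing K] {n : ℕ} (x y : K) (π : SetPartition n)
    (B : Finset ℕ) (hB : B ∈ insert ∅ π.parts) :
    (if Nonnesting (extendBlock π B hB) 3 then weight x y (extendBlock π B hB) else 0) =
      childWeight x y π (B.sup id) := by
  rw [childWeight, nonnesting_three_extendBlock, weight, endsAfterArc, endsAfterNesting,
    maxima_extendBlock, lastOpener_extendBlock, rightmostMin_extendBlock]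
  congr!

theorem sum_childWeight {K : Type*} [CommRing K] {n : ℕ} (x y : K) (π : SetPartition n)
    (hπ : Nonnesting π 3) :
    x * y * (childWeight x y π 0 + ∑ p ∈ maxima π, childWeight x y π p) =
      (1 + x + y) * (x * y + x + y) * weight x y π
        - y * (1 + x + y) ^ 2 * (1 + y) ^ endsAfterNesting π
        - x * (1 + x + y) * (1 + x + y) ^ (endsAfterArc π + 1) := by
  obtain ⟨m, hm⟩ := Nat.exists_eq_add_of_le (endsAfterArc_le π)
  have hM : ∀ q ∈ maxima π, q < n + 1 := fun q hq => Nat.lt_succ_of_le (mem_maxima_bounds hq).2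
  have hv1 := lastOpener_le π
  have hv2 := rightmostMin_le_lastOpener π
  have h0 : childWeight x y π 0 = (1 + x + y) ^ (endsAfterArc π + 2) * (1 + y) ^ m := by
    rw [childWeight, if_pos ⟨hπ, Or.inl rfl⟩]
    simp only [Nat.max_zero, ite_self]
    rw [numAbove_insert_erase_of_le hM (by omega) (Nat.zero_le _),
      numAbove_insert_erase_of_le hM (by omega) (Nat.zero_le _)]
    change _ ^ (endsAfterArc π + 1 + 1) * _ ^ (endsAfterNesting π + 1 - (endsAfterArc π + 1)) = _
    rw [hm, show endsAfterArc π + m + 1 - (endsAfterArc π + 1) = m by omega]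
  -- Here `i` counts the maxima above the chosen one, $p$. If `i < endsAfterArc π`, then $p$ is
  -- beyond the last opener and becomes the new one; otherwise $p$ becomes the new `rightmostMin`.
  let f : ℕ → K := fun i => if i < endsAfterArc π then
    (1 + x + y) ^ (i + 2) * (1 + y) ^ (endsAfterArc π + m - (i + 1))
    else (1 + x + y) ^ (endsAfterArc π + 2) * (1 + y) ^ (i - endsAfterArc π)
  have hs : ∑ p ∈ maxima π, childWeight x y π p =
      ∑ p ∈ maxima π with rightmostMin π 2 < p, f (numAbove (maxima π) p) := by
    rw [sum_filter]
    refine sum_congr rfl fun p hp => ?_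
    have hpb := mem_maxima_bounds hp
    -- These exclude ties, so each weak comparison of $p$ with a threshold is strict.
    have hp1 := lastOpener_ne hp
    have hp2 := rightmostMin_ne hp
    by_cases h2 : rightmostMin π 2 < p
    · rw [childWeight, if_pos ⟨hπ, Or.inr h2.le⟩, if_pos h2]
      simp only [f, endsAfterArc, numAbove_lt_iff hp]
      by_cases h1 : lastOpener π < p
      · rw [if_pos h1, if_neg h1.not_gt, max_eq_right h1.le,
          numAbove_insert_erase_of_le hM (by omega) le_rfl,
          numAbove_insert_erase_of_lt hM (by omega) hp h2]
        change _ * _ ^ (endsAfterNesting π - _) = _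
        rw [hm]
        rfl
      · have h1' : p < lastOpener π := by omega
        rw [if_neg h1, if_pos h1', max_eq_left h1'.le, max_eq_right h2.le,
          numAbove_insert_erase_of_le hM (by omega) le_rfl,
          numAbove_insert_erase_of_le hM (by omega) h1'.le, Nat.add_sub_add_right]
    · rw [if_neg h2, childWeight, if_neg]
      rintro ⟨-, h | h⟩ <;> omega
  rw [h0, hs, sum_numAbove_filter]
  change x * y * (_ + ∑ i ∈ range (endsAfterNesting π), _) = _
  rw [weight, hm, kernel_identity, Nat.add_sub_cancel_left]

open Classical in
/-- The `3`-nonnesting partitions of `[n]`. -/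
noncomputable def nonnestingThree (n : ℕ) : Finset (SetPartition n) :=
  univ.filter fun π => Nonnesting π 3

/-- The generating polynomial of the `3`-nonnesting partitions of `[n]` by both labels. -/
noncomputable def genBoth {K : Type*} [CommRing K] (n : ℕ) (x y : K) : K :=
  ∑ π ∈ nonnestingThree n, weight x y π

/-- The generating polynomial of the `3`-nonnesting partitions of `[n]` by `a₂ - 1`. -/
noncomputable def genNesting {K : Type*} [CommRing K] (n : ℕ) (v : K) : K :=
  ∑ π ∈ nonnestingThree n, v ^ endsAfterNesting π

/-- The generating polynomial of the `3`-nonnesting partitions of `[n]` by `a₁`. -/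
noncomputable def genArc {K : Type*} [CommRing K] (n : ℕ) (w : K) : K :=
  ∑ π ∈ nonnestingThree n, w ^ (endsAfterArc π + 1)

theorem genBoth_succ {K : Type*} [CommRing K] (n : ℕ) (x y : K) :
    x * y * genBoth (n + 1) x y =
      (1 + x + y) * (x * y + x + y) * genBoth n x y
        - y * (1 + x + y) ^ 2 * genNesting n (1 + y)
        - x * (1 + x + y) * genArc n (1 + x + y) := by
  classical
  rw [genBoth, nonnestingThree, sum_filter, sum_setPartition_succ n _ (childWeight x y)
    (fun π B hB => by convert weight_extendBlock x y π B hB), genBoth, genNesting, genArc]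
  simp only [mul_sum]
  rw [← sum_sub_distrib, ← sum_sub_distrib, nonnestingThree, sum_filter]
  refine sum_congr rfl fun π _ => ?_
  split_ifs with h
  · rw [← sum_childWeight x y π h]
  · simp [childWeight, h]

theorem genBoth_zero {K : Type*} [CommRing K] (x y : K) : genBoth 0 x y = 1 + x + y := by
  classical
  have hp : ∀ π : SetPartition 0, maxima π = ∅ := fun π =>
    eq_empty_of_forall_notMem fun p hp => by
      have := mem_maxima_bounds hp
      omega
  have hn : ∀ π : SetPartition 0, Nonnesting π 3 := fun π => by
    rw [nonnesting_three_iff]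
    intro i j hij
    have := isArc_bounds hij
    omega
  have hc : Fintype.card (SetPartition 0) = 1 :=
    Fintype.card_eq_one_iff_nonempty_unique.2 ⟨inferInstanceAs (Unique (Finpartition ⊥))⟩
  rw [genBoth, nonnestingThree, filter_true_of_mem fun π _ => hn π]
  have hw : ∀ π : SetPartition 0, weight x y π = 1 + x + y := fun π => by
    simp [weight, endsAfterArc, endsAfterNesting, hp, numAbove]
  simp only [hw, sum_const, card_univ, hc, one_smul]

theorem card_nonnestingThree (n : ℕ) : #(nonnestingThree n) = F n := by
  classical
  rw [F, Nat.card_eq_fintype_card, Fintype.card_subtype, nonnestingThree]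

theorem genNesting_eq_sum {K : Type*} [CommRing K] (n : ℕ) (v : K) :
    genNesting n v = ∑ k ∈ Icc 1 (n + 1), (Flabel n k : K) * v ^ (k - 1) := by
  classical
  rw [genNesting, ← sum_fiberwise_of_maps_to (g := fun π => label π 2)
    (fun π _ => label_two_mem π)]
  refine sum_congr rfl fun k _ => ?_
  rw [Flabel, Nat.card_eq_fintype_card, Fintype.card_subtype, ← nsmul_eq_mul, ← sum_const]
  refine sum_congr ?_ fun π hπ => ?_
  · ext π
    simp [nonnestingThree]
  · have := (mem_filter.1 hπ).2
    rw [label_two] at this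
    congr 1
    simp only [endsAfterNesting]
    omega


/-! ### Multinomials and coefficients of Laurent polynomials -/

theorem mem_triples {N : ℕ} {l : ℕ × ℕ × ℕ} : l ∈ triples N ↔ l.1 + l.2.1 + l.2.2 = N := by
  simp only [triples, mem_filter, mem_product, mem_range]
  omega

theorem mem_pairs {N : ℤ} {p : ℕ × ℕ} : p ∈ pairs N ↔ (p.1 : ℤ) + p.2 = N := by
  simp only [pairs, mem_filter, mem_product, mem_range]
  omega

theorem trinomial_pow {K : Type*} [CommRing K] (x y : K) (N : ℕ) :
    (1 + x + y) ^ N = ∑ l ∈ triples N, (multinom N l.1 l.2.1 l.2.2 : K) * (x ^ l.1 * y ^ l.2.1) := by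
  have h := sum_pow_eq_sum_piAntidiag (univ : Finset (Fin 3)) ![x, y, 1] N
  simp only [Fin.sum_univ_three, Fin.prod_univ_three] at h
  rw [show 1 + x + y = ![x, y, 1] 0 + ![x, y, 1] 1 + ![x, y, 1] 2 by
    simp only [Matrix.cons_val]; ring, h]
  refine sum_nbij' (fun k => (k 0, k 1, k 2)) (fun l => ![l.1, l.2.1, l.2.2]) ?_ ?_ ?_ ?_ ?_
  · intro k hk
    rw [mem_piAntidiag, Fin.sum_univ_three] at hk
    exact mem_triples.2 hk.1
  · intro l hl
    rw [mem_piAntidiag, Fin.sum_univ_three]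
    exact ⟨mem_triples.1 hl, fun _ _ => mem_univ _⟩
  · intro k _
    ext r
    fin_cases r <;> rfl
  · intro l _
    rfl
  · intro k hk
    rw [mem_piAntidiag, Fin.sum_univ_three] at hk
    have : ![k 0, k 1, k 2] = k := by
      ext r
      fin_cases r <;> rfl
    rw [multinom, if_pos hk.1, this]
    simp

theorem multinom_mul_factorial {N a b c : ℕ} (h : a + b + c = N) :
    multinom N a b c * (a.factorial * b.factorial * c.factorial) = N.factorial := by
  have := Nat.multinomial_spec (univ : Finset (Fin 3)) ![a, b, c]
  rw [multinom, if_pos h]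
  simp only [Fin.sum_univ_three, Fin.prod_univ_three, Matrix.cons_val] at this
  rw [h] at this
  rw [← this, mul_comm]

theorem binom_succ (k : ℕ) (j : ℤ) : binom (k + 1) j = binom k j + binom k (j - 1) := by
  unfold binom
  rcases lt_trichotomy j 0 with h | rfl | h
  · rw [if_neg (by omega), if_neg (by omega), if_neg (by omega)]
  · simp
  · obtain ⟨m, rfl⟩ : ∃ m : ℕ, j = m + 1 := ⟨(j - 1).toNat, by omega⟩
    rw [if_pos (by omega), if_pos (by omega), if_pos (by omega), add_sub_cancel_right,
      Int.toNat_natCast, show ((m : ℤ) + 1).toNat = m + 1 by omega, Nat.choose_succ_succ, add_comm]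

theorem binom_zero (j : ℤ) : binom 0 j = if j = 0 then 1 else 0 := by
  unfold binom
  rcases lt_trichotomy j 0 with h | rfl | h
  · rw [if_neg (by omega), if_neg (by omega)]
  · simp
  · rw [if_pos h.le, if_neg h.ne', Nat.choose_eq_zero_of_lt (by omega)]

/-- Laurent polynomials in two variables. -/
abbrev Laurent : Type := AddMonoidAlgebra ℚ (ℤ × ℤ)

/-- The Laurent monomial with exponents `i` and `j`. -/
noncomputable def mono (i j : ℤ) : Laurent := AddMonoidAlgebra.single (i, j) 1

/-- The coefficient functional of the monomial with exponents `i` and `j`. -/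
noncomputable def coef (i j : ℤ) : Laurent →+ ℚ where
  toFun f := f.coeff (i, j)
  map_zero' := rfl
  map_add' _ _ := rfl

theorem mono_mul_mono (i j i' j' : ℤ) : mono i j * mono i' j' = mono (i + i') (j + j') := by
  simp [mono, AddMonoidAlgebra.single_mul_single]

theorem mono_zero : mono 0 0 = 1 := rfl

theorem mono_pow (i j : ℤ) (k : ℕ) : mono i j ^ k = mono (k * i) (k * j) := by
  induction k with
  | zero => simp [mono_zero]
  | succ k ih =>
    rw [pow_succ, ih, mono_mul_mono]
    congr 1 <;> push_cast <;> ring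

theorem coef_mono_mul (i j a b : ℤ) (f : Laurent) :
    coef i j (mono a b * f) = coef (i - a) (j - b) f := by
  change (mono a b * f).coeff (i, j) = f.coeff (i - a, j - b)
  rw [mono, AddMonoidAlgebra.coeff_single_mul_apply, one_mul]
  congr 1
  ext <;> simp <;> ring

theorem coef_natCast_mul (i j : ℤ) (c : ℕ) (f : Laurent) :
    coef i j ((c : Laurent) * f) = c * coef i j f := by
  rw [← nsmul_eq_mul, map_nsmul, nsmul_eq_mul]

theorem coef_one (i j : ℤ) : coef i j 1 = if i = 0 ∧ j = 0 then 1 else 0 := by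
  change (AddMonoidAlgebra.single (0, 0) (1 : ℚ)).coeff (i, j) = _
  rw [AddMonoidAlgebra.coeff_single, Finsupp.single_apply]
  simp [Prod.ext_iff, eq_comm]

theorem coef_one_add_snd_pow (k : ℕ) (i j : ℤ) :
    coef i j ((1 + mono 0 1) ^ k) = if i = 0 then (binom k j : ℚ) else 0 := by
  induction k generalizing i j with
  | zero =>
    rw [pow_zero, coef_one, binom_zero]
    split_ifs <;> simp_all
  | succ k ih =>
    rw [pow_succ', add_mul, one_mul, map_add, coef_mono_mul, ih, ih, binom_succ, sub_zero]
    split_ifs <;> simp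

theorem coef_one_add_fst_pow (k : ℕ) (i j : ℤ) :
    coef i j ((1 + mono 1 0) ^ k) = if j = 0 then (binom k i : ℚ) else 0 := by
  induction k generalizing i j with
  | zero =>
    rw [pow_zero, coef_one, binom_zero]
    split_ifs <;> simp_all
  | succ k ih =>
    rw [pow_succ', add_mul, one_mul, map_add, coef_mono_mul, ih, ih, binom_succ, sub_zero]
    split_ifs <;> simp

theorem coef_trinomial_pow_mul (d : ℕ) (i j : ℤ) (f : Laurent) :
    coef i j ((1 + mono 1 0 + mono 0 1) ^ d * f) =
      ∑ l ∈ triples d, (multinom d l.1 l.2.1 l.2.2 : ℚ) * coef (i - l.1) (j - l.2.1) f := by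
  rw [trinomial_pow, sum_mul, map_sum]
  refine sum_congr rfl fun l _ => ?_
  rw [mul_assoc, coef_natCast_mul, mono_pow, mono_pow, mono_mul_mono, coef_mono_mul]
  simp

theorem coef_trinomial_inv_pow_mul (d : ℕ) (i j : ℤ) (f : Laurent) :
    coef i j ((1 + mono (-1) 0 + mono 0 (-1)) ^ d * f) =
      ∑ l ∈ triples d, (multinom d l.1 l.2.1 l.2.2 : ℚ) * coef (i + l.1) (j + l.2.1) f := by
  rw [trinomial_pow, sum_mul, map_sum]
  refine sum_congr rfl fun l _ => ?_
  rw [mul_assoc, coef_natCast_mul, mono_pow, mono_pow, mono_mul_mono, coef_mono_mul]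
  simp

/-- The factor $(1+y)^k$ contains no $x$, so the trinomial must supply the whole exponent $i$ of
$x$. With $N$ an integer, the case $i>d$ is an empty sum. -/
theorem coef_trinomial_pow_mul_snd_pow (d k i : ℕ) (i' j N : ℤ) (hi : i' = i) (hN : N = d - i) :
    coef i' j ((1 + mono 1 0 + mono 0 1) ^ d * (1 + mono 0 1) ^ k) =
      ∑ p ∈ pairs N, (multinom d i p.1 p.2 : ℚ) * (binom k (j - p.1) : ℚ) := by
  subst hi hN
  simp only [coef_trinomial_pow_mul, coef_one_add_snd_pow, mul_ite, mul_zero]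
  rw [← sum_filter]
  refine sum_nbij' (fun l => l.2) (fun p => (i, p)) ?_ ?_ ?_ ?_ ?_
  · intro l hl
    rw [mem_filter, mem_triples] at hl
    rw [mem_pairs]
    omega
  · intro p hp
    rw [mem_pairs] at hp
    rw [mem_filter, mem_triples]
    constructor
    · simp only
      omega
    · simp
  · intro l hl
    rw [mem_filter] at hl
    ext
    · simp only
      omega
    · rfl
    · rfl
  · intro p _
    rfl
  · intro l hl
    rw [mem_filter] at hl
    rw [show l.1 = i by omega]

theorem coef_trinomial_pow_mul_fst_pow (d k i : ℕ) (i' j N : ℤ) (hi : i' = i) (hN : N = d - i) :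
    coef j i' ((1 + mono 1 0 + mono 0 1) ^ d * (1 + mono 1 0) ^ k) =
      ∑ p ∈ pairs N, (multinom d p.1 i p.2 : ℚ) * (binom k (j - p.1) : ℚ) := by
  subst hi hN
  simp only [coef_trinomial_pow_mul, coef_one_add_fst_pow, mul_ite, mul_zero]
  rw [← sum_filter]
  refine sum_nbij' (fun l => (l.1, l.2.2)) (fun p => (p.1, i, p.2)) ?_ ?_ ?_ ?_ ?_
  · intro l hl
    rw [mem_filter, mem_triples] at hl
    rw [mem_pairs]
    simp only
    omega
  · intro p hp
    rw [mem_pairs] at hp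
    rw [mem_filter, mem_triples]
    constructor
    · simp only
      omega
    · simp
  · intro l hl
    rw [mem_filter] at hl
    ext
    · rfl
    · simp only
      omega
    · rfl
  · intro p _
    rfl
  · intro l hl
    rw [mem_filter] at hl
    rw [show l.2.1 = i by omega]

theorem coef_trinomial_pow (d i j m : ℕ) (h : i + j + m = d) :
    coef i j ((1 + mono 1 0 + mono 0 1) ^ d) = multinom d i j m := by
  rw [← mul_one ((1 + mono 1 0 + mono 0 1) ^ d), coef_trinomial_pow_mul,
    sum_eq_single_of_mem (i, j, m) (mem_triples.2 h)]
  · simp [coef_one]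
  · intro l hl hne
    rw [coef_one, if_neg, mul_zero]
    rintro ⟨h1, h2⟩
    have := mem_triples.1 hl
    apply hne
    ext <;> simp only <;> omega

theorem coef_trinomial_pow_of_neg (d : ℕ) (i j : ℤ) (h : i < 0) :
    coef i j ((1 + mono 1 0 + mono 0 1) ^ d) = 0 := by
  rw [← mul_one ((1 + mono 1 0 + mono 0 1) ^ d), coef_trinomial_pow_mul]
  refine sum_eq_zero fun l _ => ?_
  rw [coef_one, if_neg (by omega), mul_zero]

/-- `f` is a polynomial with constant term one. -/
def IsUnitalPoly (f : Laurent) : Prop :=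
  coef 0 0 f = 1 ∧ ∀ i j, i < 0 ∨ j < 0 → coef i j f = 0

theorem isUnitalPoly_one : IsUnitalPoly 1 := by
  refine ⟨by simp [coef_one], fun i j h => ?_⟩
  rw [coef_one, if_neg (by omega)]

theorem IsUnitalPoly.trinomial_mul {f : Laurent} (hf : IsUnitalPoly f) :
    IsUnitalPoly ((1 + mono 1 0 + mono 0 1) * f) := by
  constructor
  · rw [add_mul, add_mul, one_mul, map_add, map_add, coef_mono_mul, coef_mono_mul, hf.1,
      hf.2 _ _ (by simp), hf.2 _ _ (by simp)]
    simp
  · intro i j h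
    rw [add_mul, add_mul, one_mul, map_add, map_add, coef_mono_mul, coef_mono_mul, hf.2 _ _ h,
      hf.2 _ _ (by omega), hf.2 _ _ (by omega)]
    simp

theorem IsUnitalPoly.one_add_mul {f : Laurent} (hf : IsUnitalPoly f) (a b : ℕ)
    (hab : a + b = 1) : IsUnitalPoly ((1 + mono a b) * f) := by
  constructor
  · rw [add_mul, one_mul, map_add, coef_mono_mul, hf.1, hf.2 _ _ (by omega)]
    simp
  · intro i j h
    rw [add_mul, one_mul, map_add, coef_mono_mul, hf.2 _ _ h, hf.2 _ _ (by omega)]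
    simp

/-- Applied to each `weight`: every partition contributes $1$ to the constant term of `genBoth`, and
no negative exponents occur. -/
theorem isUnitalPoly_pow_mul_pow (a b : ℕ) (hab : a + b = 1) (c m : ℕ) :
    IsUnitalPoly ((1 + mono 1 0 + mono 0 1) ^ c * (1 + mono a b) ^ m) := by
  induction c with
  | zero =>
    rw [pow_zero, one_mul]
    induction m with
    | zero => simpa using isUnitalPoly_one
    | succ m ih =>
      rw [pow_succ']
      exact ih.one_add_mul a b hab
  | succ c ih =>
    rw [pow_succ', mul_assoc]
    exact ih.trinomial_mul

/-! ### Antisymmetrization and the solved recurrence -/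

/-- The antisymmetrized generating polynomial. -/
noncomputable def antisym (n : ℕ) : Laurent :=
  mono 0 1 * genBoth n (mono 1 0) (mono 0 1) - mono 1 0 * genBoth n (mono 0 1) (mono 1 0)

theorem coef_antisym (n : ℕ) : coef 0 1 (antisym n) = F n := by
  have h1 : coef 0 0 (genBoth n (mono 1 0) (mono 0 1)) = F n := by
    rw [genBoth, map_sum, ← card_nonnestingThree, card_eq_sum_ones, Nat.cast_sum]
    refine sum_congr rfl fun π _ => ?_
    rw [weight]
    simpa using (isUnitalPoly_pow_mul_pow 0 1 rfl _ _).1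
  have h2 : coef (-1) 1 (genBoth n (mono 0 1) (mono 1 0)) = 0 := by
    rw [genBoth, map_sum]
    refine sum_eq_zero fun π _ => ?_
    rw [weight, add_right_comm]
    simpa using (isUnitalPoly_pow_mul_pow 1 0 rfl _ _).2 (-1) 1 (by simp)
  rw [antisym, map_sub, coef_mono_mul, coef_mono_mul]
  simp [h1, h2]

/-- The correction term of the recurrence for `antisym`. -/
noncomputable def correction (n : ℕ) : Laurent :=
  (1 + mono 1 0 + mono 0 1) ^ 2 * (mono (-1) 1 * genNesting n (1 + mono 0 1) -
    mono 1 (-1) * genNesting n (1 + mono 1 0))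

theorem antisym_succ (n : ℕ) :
    antisym (n + 1) =
      (1 + mono 1 0 + mono 0 1) * (1 + mono (-1) 0 + mono 0 (-1)) * antisym n - correction n := by
  have e1 : mono 1 0 * mono (-1) 0 = 1 := by rw [mono_mul_mono]; rfl
  have e2 : mono 0 1 * mono 0 (-1) = 1 := by rw [mono_mul_mono]; rfl
  have e3 : mono (-1) 1 = mono (-1) 0 * mono 0 1 := by rw [mono_mul_mono]; rfl
  have e4 : mono 1 (-1) = mono 1 0 * mono 0 (-1) := by rw [mono_mul_mono]; rfl
  have g1 := genBoth_succ n (mono 1 0) (mono 0 1)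
  have g2 := genBoth_succ n (mono 0 1) (mono 1 0)
  -- This puts $1+y+x$ in the form $1+x+y$, so both equations contain the same `genArc` term, which
  -- cancels in `y * g1 - x * g2`.
  rw [add_right_comm] at g2
  rw [antisym, antisym, correction, e3, e4]
  generalize mono 1 0 = x at *
  generalize mono 0 1 = y at *
  generalize mono (-1) 0 = a at *
  generalize mono 0 (-1) = b at *
  have hu : x * y * (a * b) = 1 := by linear_combination e1 * (y * b) + e2
  -- The monomial $xy$ is a unit with inverse $ab$, so it is enough to compare multiples by $xy$.
  suffices h : x * y * (y * genBoth (n + 1) x y - x * genBoth (n + 1) y x) =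
      x * y * ((1 + x + y) * (1 + a + b) * (y * genBoth n x y - x * genBoth n y x) -
        (1 + x + y) ^ 2 * (a * y * genNesting n (1 + y) - x * b * genNesting n (1 + x))) by
    have := congrArg (fun t => a * b * t) h
    simp only [← mul_assoc] at this
    rw [show a * b * x * y = 1 by linear_combination hu] at this
    linear_combination this
  linear_combination y * g1 - x * g2
    - (1 + x + y) * (y * genBoth n x y - x * genBoth n y x) * (y * e1 + x * e2)
    + (1 + x + y) ^ 2 * (y ^ 2 * genNesting n (1 + y) * e1 - x ^ 2 * genNesting n (1 + x) * e2)

theorem antisym_zero : antisym 0 = (mono 0 1 - mono 1 0) * (1 + mono 1 0 + mono 0 1) := by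
  rw [antisym, genBoth_zero, genBoth_zero]
  ring

theorem antisym_eq (n : ℕ) :
    antisym n = (1 + mono (-1) 0 + mono 0 (-1)) ^ n *
        ((mono 0 1 - mono 1 0) * (1 + mono 1 0 + mono 0 1) ^ (n + 1)) -
      ∑ s ∈ range n, (1 + mono (-1) 0 + mono 0 (-1)) ^ (n - s - 1) *
        ((1 + mono 1 0 + mono 0 1) ^ (n - s - 1) * correction s) := by
  induction n with
  | zero => simp [antisym_zero]
  | succ n ih =>
    rw [antisym_succ, ih, sum_range_succ, mul_sub, mul_sum]
    have : ∑ s ∈ range n, (1 + mono 1 0 + mono 0 1) * (1 + mono (-1) 0 + mono 0 (-1)) *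
          ((1 + mono (-1) 0 + mono 0 (-1)) ^ (n - s - 1) *
            ((1 + mono 1 0 + mono 0 1) ^ (n - s - 1) * correction s)) =
        ∑ s ∈ range n, (1 + mono (-1) 0 + mono 0 (-1)) ^ (n + 1 - s - 1) *
            ((1 + mono 1 0 + mono 0 1) ^ (n + 1 - s - 1) * correction s) := by
      refine sum_congr rfl fun s hs => ?_
      rw [show n + 1 - s - 1 = n - s - 1 + 1 by have := mem_range.1 hs; omega]
      ring
    rw [this, show n + 1 - n - 1 = 0 by omega]
    ring

/-! ### Extracting the coefficient of $x^0y^1$ -/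

theorem coef_main_term (n : ℕ) :
    coef 0 1 ((1 + mono (-1) 0 + mono 0 (-1)) ^ n *
        ((mono 0 1 - mono 1 0) * (1 + mono 1 0 + mono 0 1) ^ (n + 1))) =
      ∑ l ∈ triples n, (multinom n l.1 l.2.1 l.2.2 : ℚ) *
        (multinom (n + 1) l.1 l.2.1 (l.2.2 + 1) : ℚ) * (1 - (l.1 : ℚ) / ((l.2.1 : ℚ) + 1)) := by
  rw [coef_trinomial_inv_pow_mul]
  refine sum_congr rfl fun ⟨a, b, c⟩ hl => ?_
  have hl' : a + b + c = n := mem_triples.1 hl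
  rw [mul_assoc]
  congr 1
  rw [sub_mul, map_sub, coef_mono_mul, coef_mono_mul]
  have h1 : coef (0 + (a : ℤ) - 0) (1 + (b : ℤ) - 1) ((1 + mono 1 0 + mono 0 1) ^ (n + 1)) =
      multinom (n + 1) a b (c + 1) := by
    rw [← coef_trinomial_pow (n + 1) a b (c + 1) (by omega)]
    congr 2 <;> ring
  -- Moving one unit from the first lower index to the second multiplies the multinomial by
  -- $a/(b+1)$; for $a=0$ both sides vanish.
  have h2 : coef (0 + (a : ℤ) - 1) (1 + (b : ℤ) - 0) ((1 + mono 1 0 + mono 0 1) ^ (n + 1)) =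
      multinom (n + 1) a b (c + 1) * ((a : ℚ) / ((b : ℚ) + 1)) := by
    rcases a with - | a
    · rw [coef_trinomial_pow_of_neg _ _ _ (by simp)]
      simp
    · have e : coef (0 + ((a + 1 : ℕ) : ℤ) - 1) (1 + (b : ℤ) - 0)
          ((1 + mono 1 0 + mono 0 1) ^ (n + 1)) = multinom (n + 1) a (b + 1) (c + 1) := by
        rw [← coef_trinomial_pow (n + 1) a (b + 1) (c + 1) (by omega)]
        congr 2 <;> push_cast <;> ring
      have f1 := multinom_mul_factorial (show a + 1 + b + (c + 1) = n + 1 by omega)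
      have f2 := multinom_mul_factorial (show a + (b + 1) + (c + 1) = n + 1 by omega)
      rw [← f1, Nat.factorial_succ a, Nat.factorial_succ b] at f2
      have f3 : multinom (n + 1) a (b + 1) (c + 1) * (b + 1) =
          multinom (n + 1) (a + 1) b (c + 1) * (a + 1) := by
        have hpos : 0 < a.factorial * b.factorial * (c + 1).factorial := by positivity
        apply Nat.eq_of_mul_eq_mul_right hpos
        linear_combination f2
      rw [e]
      have hb : (b : ℚ) + 1 ≠ 0 := by positivity
      field_simp
      exact_mod_cast f3
  simp only
  rw [h1, h2]
  ring

theorem coef_correction_term (n s : ℕ) (hs : s < n) :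
    coef 0 1 ((1 + mono (-1) 0 + mono 0 (-1)) ^ (n - s - 1) *
        ((1 + mono 1 0 + mono 0 1) ^ (n - s - 1) * correction s)) =
      ∑ k ∈ Icc 1 (s + 1), (Flabel s k : ℚ) *
          ∑ l ∈ triples (n - s - 1), (multinom (n - s - 1) l.1 l.2.1 l.2.2 : ℚ) *
            ((∑ j ∈ pairs ((n : ℤ) - s - 1 - l.1),
                (multinom (n - s) (l.1 + 1) j.1 j.2 : ℚ) * (binom k ((l.2.1 : ℤ) - j.1) : ℚ))
            - (∑ j ∈ pairs ((n : ℤ) - s - 2 - l.2.1),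
                (multinom (n - s) j.1 (l.2.1 + 2) j.2 : ℚ) * (binom k ((l.1 : ℤ) - j.1 - 1) : ℚ))
            + (∑ j ∈ pairs ((n : ℤ) - s - l.1),
                (multinom (n - s) l.1 j.1 j.2 : ℚ) * (binom (k - 1) ((l.2.1 : ℤ) - j.1) : ℚ))
            - (∑ j ∈ pairs ((n : ℤ) - s - 1 - l.2.1),
                (multinom (n - s) j.1 (l.2.1 + 1) j.2 : ℚ) *
                  (binom (k - 1) ((l.1 : ℤ) - j.1 - 1) : ℚ))) := by
  obtain ⟨d, rfl⟩ : ∃ d, n = s + d + 1 := ⟨n - s - 1, by omega⟩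
  rw [show s + d + 1 - s - 1 = d by omega, show s + d + 1 - s = d + 1 by omega]
  -- One of the $d+2$ factors $1+x+y$ is split as $(1+y)+x$ next to $(1+y)^{k-1}$, and as $(1+x)+y$
  -- next to $(1+x)^{k-1}$. This produces the four sums of $C_{n-n^*,k}$, with $n-n^*=d+1$.
  have expand : (1 + mono 1 0 + mono 0 1) ^ d * correction s =
      ∑ k ∈ Icc 1 (s + 1), (Flabel s k : Laurent) *
        (mono (-1) 1 * ((1 + mono 1 0 + mono 0 1) ^ (d + 1) * (1 + mono 0 1) ^ k)
          - mono 1 (-1) * ((1 + mono 1 0 + mono 0 1) ^ (d + 1) * (1 + mono 1 0) ^ k)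
          + mono 0 1 * ((1 + mono 1 0 + mono 0 1) ^ (d + 1) * (1 + mono 0 1) ^ (k - 1))
          - mono 1 0 * ((1 + mono 1 0 + mono 0 1) ^ (d + 1) * (1 + mono 1 0) ^ (k - 1))) := by
    have e3 : mono (-1) 1 * mono 1 0 = mono 0 1 := by rw [mono_mul_mono]; rfl
    have e4 : mono 1 (-1) * mono 0 1 = mono 1 0 := by rw [mono_mul_mono]; rfl
    rw [correction, genNesting_eq_sum, genNesting_eq_sum]
    simp only [mul_sum, ← sum_sub_distrib]
    refine sum_congr rfl fun k hk => ?_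
    obtain ⟨m, rfl⟩ : ∃ m, k = m + 1 := ⟨k - 1, by have := mem_Icc.1 hk; omega⟩
    rw [Nat.add_sub_cancel, pow_succ (1 + mono 0 1) m, pow_succ (1 + mono 1 0) m]
    linear_combination (Flabel s (m + 1) : Laurent) * (1 + mono 1 0 + mono 0 1) ^ (d + 1) *
      ((1 + mono 0 1) ^ m * e3 - (1 + mono 1 0) ^ m * e4)
  rw [expand]
  simp only [mul_sum, map_sum]
  refine sum_congr rfl fun k _ => ?_
  rw [mul_left_comm, coef_natCast_mul, coef_trinomial_inv_pow_mul, mul_sum]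
  refine sum_congr rfl fun l _ => ?_
  congr 2
  rw [map_sub, map_add, map_sub, coef_mono_mul, coef_mono_mul, coef_mono_mul, coef_mono_mul]
  rw [coef_trinomial_pow_mul_snd_pow (d + 1) k (l.1 + 1) _ _ ((s + d + 1 : ℕ) - s - 1 - l.1)
      (by push_cast; ring) (by push_cast; ring),
    coef_trinomial_pow_mul_fst_pow (d + 1) k (l.2.1 + 2) _ _ ((s + d + 1 : ℕ) - s - 2 - l.2.1)
      (by push_cast; ring) (by push_cast; ring),
    coef_trinomial_pow_mul_snd_pow (d + 1) (k - 1) l.1 _ _ ((s + d + 1 : ℕ) - s - l.1)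
      (by ring) (by push_cast; ring),
    coef_trinomial_pow_mul_fst_pow (d + 1) (k - 1) (l.2.1 + 1) _ _
      ((s + d + 1 : ℕ) - s - 1 - l.2.1) (by push_cast; ring) (by push_cast; ring)]
  simp only [zero_add, add_sub_cancel_left, sub_right_comm _ (1 : ℤ)]

end NonnestingPartition

open NonnestingPartition in
theorem mainTheorem4 (n : ℕ) :
    (F n : ℚ) =
      (∑ l ∈ triples n,
        (multinom n l.1 l.2.1 l.2.2 : ℚ) * (multinom (n + 1) l.1 l.2.1 (l.2.2 + 1) : ℚ)
          * (1 - (l.1 : ℚ) / ((l.2.1 : ℚ) + 1)))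
      - ∑ s ∈ Finset.range n, ∑ k ∈ Finset.Icc 1 (s + 1), (Flabel s k : ℚ) *
          ∑ l ∈ triples (n - s - 1), (multinom (n - s - 1) l.1 l.2.1 l.2.2 : ℚ) *
            ((∑ j ∈ pairs ((n : ℤ) - s - 1 - l.1),
                (multinom (n - s) (l.1 + 1) j.1 j.2 : ℚ) * (binom k ((l.2.1 : ℤ) - j.1) : ℚ))
            - (∑ j ∈ pairs ((n : ℤ) - s - 2 - l.2.1),
                (multinom (n - s) j.1 (l.2.1 + 2) j.2 : ℚ) * (binom k ((l.1 : ℤ) - j.1 - 1) : ℚ))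
            + (∑ j ∈ pairs ((n : ℤ) - s - l.1),
                (multinom (n - s) l.1 j.1 j.2 : ℚ) * (binom (k - 1) ((l.2.1 : ℤ) - j.1) : ℚ))
            - (∑ j ∈ pairs ((n : ℤ) - s - 1 - l.2.1),
                (multinom (n - s) j.1 (l.2.1 + 1) j.2 : ℚ) *
                  (binom (k - 1) ((l.1 : ℤ) - j.1 - 1) : ℚ))) := by
  rw [← coef_antisym, antisym_eq, map_sub, coef_main_term, map_sum]
  congr 1
  exact Finset.sum_congr rfl fun s hs => coef_correction_term n s (Finset.mem_range.1 hs)
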